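/- Let $\mathcal K$ be the class of nonconstant power series $f(z)=\sum_{j\ge 0}a_jz^j$ with real coefficients $a_j\ge 0$, $a_0>0$, and positive radius of convergence $R\in(0,\infty]$. For $f\in\mathcal K$ and $t\in[0,R)$ let $X_t$ be a random variable with $P(X_t=j)=a_jt^j/f(t)$ for $j\ge 0$ (so $X_0\equiv 0$), and write $m_f(t)=E(X_t)$, $\sigma_f^2(t)=\mathrm{Var}(X_t)$ with $\sigma_f(t)\ge 0$, $M_f=\lim_{t\uparrow R}m_f(t)\in(0,\infty]$ and $Q_f=\gcd\{j\ge 1: a_j\ne 0\}$. Theorem. Let $\psi\in\mathcal K$ have radius of convergence $R$, and let $0<A<B<M_\psi$. For all integers $n\ge 1$, $k\ge 0$ such that $A\le k/n\le B$ and $k$ is a multiple of $Q_\psi$, there is a unique $\tau=\tau_{n,k}\in[0,R)$ with $m_\psi(\tau)=k/n$, and $$\mathrm{coeff}_{[k]}(\psi(z)^n)\;\sim\;\frac{Q_\psi}{\sqrt{2\pi}}\;\frac{\psi(\tau_{n,k})^n}{\tau_{n,k}^{\,k}}\;\frac{1}{\sqrt n\,\sigma_\psi(\tau_{n,k})}$$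 as $n\to\infty$ while $A\le k/n\le B$ and $k$ is a multiple of $Q_\psi$; that is, the ratio of the two sides tends to $1$ as $n\to\infty$, uniformly over all such $k$. -/

import Mathlib

open Filter Topology Asymptotics

noncomputable section

/-- The radius of convergence `R ∈ [0, ∞]` of the power series `f(z) = ∑ aₙ zⁿ`. -/
def convergenceRadius (f : PowerSeries ℝ) : ENNReal :=
  (FormalMultilinearSeries.ofScalars ℝ (fun n => PowerSeries.coeff n f)).radius

/-- The class `𝒦`: nonconstant power series with positive radius of convergence, nonnegative
coefficients and positive constant coefficient. -/
def khinchinClass : Set (PowerSeries ℝ) :=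
  {f | (∀ n, 0 ≤ PowerSeries.coeff n f) ∧ 0 < PowerSeries.coeff 0 f ∧
    (∃ n, 1 ≤ n ∧ PowerSeries.coeff n f ≠ 0) ∧ 0 < convergenceRadius f}

/-- The interval `[0, R)`, with `R` the radius of convergence of `f`. -/
def khinchinDomain (f : PowerSeries ℝ) : Set ℝ :=
  {t | 0 ≤ t ∧ ENNReal.ofReal t < convergenceRadius f}

/-- The value `f(t) = ∑ aₙ tⁿ`. -/
def seriesValue (f : PowerSeries ℝ) (t : ℝ) : ℝ :=
  ∑' n : ℕ, PowerSeries.coeff n f * t ^ n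

/-- The mass function `P(X_t = n) = aₙ tⁿ / f(t)` of the Khinchin family of `f`
(as `0 ^ 0 = 1`, for `t = 0` this is the mass function of the constant `0`). -/
def khinchinMass (f : PowerSeries ℝ) (t : ℝ) (n : ℕ) : ℝ :=
  PowerSeries.coeff n f * t ^ n / seriesValue f t

/-- The mean `m_f(t) = E(X_t)`. -/
def khinchinMean (f : PowerSeries ℝ) (t : ℝ) : ℝ :=
  ∑' n : ℕ, (n : ℝ) * khinchinMass f t n

/-- The variance `σ_f²(t) = V(X_t)`. -/
def khinchinVariance (f : PowerSeries ℝ) (t : ℝ) : ℝ :=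
  ∑' n : ℕ, ((n : ℝ) - khinchinMean f t) ^ 2 * khinchinMass f t n

/-- The standard deviation `σ_f(t)`. -/
def khinchinSigma (f : PowerSeries ℝ) (t : ℝ) : ℝ :=
  √(khinchinVariance f t)

/-- `M_f = lim_{t ↑ R} m_f(t)`, in the extended reals; `R = ∞` is allowed. The mean is monotone on
`[0, R)` for `f` in the class `𝒦`, so that the limit exists. -/
def khinchinMeanLimit (f : PowerSeries ℝ) : EReal :=
  limUnder (comap (fun t : ℝ => (t : EReal)) (𝓝[<] (convergenceRadius f : EReal)))
    (fun t : ℝ => (khinchinMean f t : EReal))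

/-- `Q_f`, the greatest common divisor of the indices `n ≥ 1` with `aₙ ≠ 0`. -/
def seriesGcd (f : PowerSeries ℝ) : ℕ :=
  sSup {d : ℕ | ∀ n : ℕ, 1 ≤ n → PowerSeries.coeff n f ≠ 0 → d ∣ n}

/-- The pairs `(n, k)` with `n ≥ 1`, `A ≤ k / n ≤ B` and `k` a multiple of `Q_f`. -/
def comparablePairs (f : PowerSeries ℝ) (A B : ℝ) : Set (ℕ × ℕ) :=
  {p | 1 ≤ p.1 ∧ A ≤ (p.2 : ℝ) / (p.1 : ℝ) ∧ (p.2 : ℝ) / (p.1 : ℝ) ≤ B ∧ seriesGcd f ∣ p.2}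

/-- The filter "`n → ∞` while `(n, k)` stays in `S`". Statements along it are uniform in `k`. -/
def powerTendsTo (S : Set (ℕ × ℕ)) : Filter (ℕ × ℕ) :=
  comap Prod.fst atTop ⊓ 𝓟 S

end

/-!
The proof is the saddle point method in its probabilistic form. Let `Q` be the greatest common
divisor `Q_ψ` and let `φ_t` be the characteristic function of `X_t - m(t)` (`centredCharFun`). The
number `coeff_k (ψ ^ n) t ^ k / ψ(t) ^ n` is the probability that `n` independent copies of `X_t`
add up to `k`. As `ψ ^ n` is supported on the multiples of `Q`, Fourier inversion over the single
period `[-π/Q, π/Q]` expresses it through the integral of `φ_t ^ n`, provided that `Q ∣ k` and that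
`t` is chosen with `n m(t) = k` (`integral_centredCharFun_pow`). The claim is then a local central
limit theorem, uniform for `t` in a compact subset of `(0, R)`.

The mean is continuous and strictly increasing (`khinchinMean_strictMonoOn`), and it exceeds `B`
somewhere (`exists_lt_khinchinMean`). This gives the existence and uniqueness of `τ`, and confines
`τ` to a compact interval `[a, b]` in `(0, R)` with `m(a) = A`.

The local limit theorem (`tendsto_localLimit`) is Laplace's method with a parameter
(`tendsto_sqrt_mul_integral_pow`): dominated convergence after the substitution `θ = u / √n`, along
the filter of admissible pairs, so that uniformity in `k` comes for free. It needs two facts that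
are uniform in `t ∈ [a, b]`:

* the expansion `φ_t(θ) = 1 - σ² θ² / 2 + O(θ³)`, which comes from a bound on the third moments
  (`norm_centredCharFun_sub_le`, `exists_centred_moment_bound`);
* the decay `‖φ_t(θ)‖ ≤ exp (-c θ²)` for `|θ| ≤ π/Q` (`exists_norm_centredCharFun_le`). The integers
  `g` with `1 - cos (g θ) = O(1 - ‖φ_t(θ)‖)` form a subgroup of `ℤ` which contains every index of a
  nonzero coefficient, hence `Q`, and `1 - cos (Q θ)` is at least a multiple of `θ²` for
  `|θ| ≤ π/Q`.
-/

section

variable {f : PowerSeries ℝ}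

/-! ### Moments and monotonicity of the mean -/

theorem mem_khinchinDomain_of_le {s t : ℝ} (hs : 0 ≤ s) (hst : s ≤ t) (ht : t ∈ khinchinDomain f) :
    s ∈ khinchinDomain f :=
  ⟨hs, (ENNReal.ofReal_le_ofReal hst).trans_lt ht.2⟩

/-- Inside the radius of convergence the series converges absolutely, even with a polynomial
weight. This gives the finiteness of all moments of the Khinchin family. -/
theorem summable_pow_mul_coeff (hf : f ∈ khinchinClass) {t : ℝ} (ht : t ∈ khinchinDomain f) (k : ℕ) :
    Summable fun n : ℕ => (n : ℝ) ^ k * (PowerSeries.coeff n f * t ^ n) := by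
  obtain ⟨r, hr1, hr2⟩ := ENNReal.lt_iff_exists_nnreal_btwn.1 ht.2
  obtain ⟨C, hC, hb⟩ := FormalMultilinearSeries.norm_mul_pow_le_of_lt_radius _ hr2
  have htr : t < r := by
    rw [← ENNReal.ofReal_coe_nnreal] at hr1
    exact (ENNReal.ofReal_lt_ofReal_iff_of_nonneg ht.1).1 hr1
  have hr0 : (0 : ℝ) < r := ht.1.trans_lt htr
  have hq : ‖t / r‖ < 1 := by
    rw [Real.norm_of_nonneg (div_nonneg ht.1 hr0.le)]
    exact (div_lt_one hr0).2 htr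
  refine Summable.of_nonneg_of_le (fun n => ?_) (fun n => ?_)
    ((summable_pow_mul_geometric_of_norm_lt_one k hq).mul_left C)
  · have := hf.1 n
    have := ht.1
    positivity
  · have h := hb n
    rw [FormalMultilinearSeries.ofScalars_norm, Real.norm_of_nonneg (hf.1 n)] at h
    have h2 : PowerSeries.coeff n f * t ^ n
        = (PowerSeries.coeff n f * r ^ n) * (t / r) ^ n := by
      rw [div_pow]
      field_simp
    rw [h2]
    calc (n : ℝ) ^ k * ((PowerSeries.coeff n f * r ^ n) * (t / r) ^ n)
        = (PowerSeries.coeff n f * r ^ n) * ((n : ℝ) ^ k * (t / r) ^ n) := by ring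
      _ ≤ C * ((n : ℝ) ^ k * (t / r) ^ n) := by
        have := div_nonneg ht.1 hr0.le
        gcongr

theorem summable_coeff_mul_pow (hf : f ∈ khinchinClass) {t : ℝ} (ht : t ∈ khinchinDomain f) :
    Summable fun n : ℕ => PowerSeries.coeff n f * t ^ n := by
  simpa using summable_pow_mul_coeff hf ht 0

theorem coeff_zero_le_seriesValue (hf : f ∈ khinchinClass) {t : ℝ} (ht : t ∈ khinchinDomain f) :
    PowerSeries.coeff 0 f ≤ seriesValue f t := by
  have := (summable_coeff_mul_pow hf ht).le_tsum 0
    (fun n _ => mul_nonneg (hf.1 n) (pow_nonneg ht.1 n))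
  rwa [pow_zero, mul_one] at this

theorem seriesValue_pos (hf : f ∈ khinchinClass) {t : ℝ} (ht : t ∈ khinchinDomain f) :
    0 < seriesValue f t :=
  hf.2.1.trans_le (coeff_zero_le_seriesValue hf ht)

theorem seriesValue_le_seriesValue (hf : f ∈ khinchinClass) {s t : ℝ} (hs : 0 ≤ s) (hst : s ≤ t)
    (ht : t ∈ khinchinDomain f) : seriesValue f s ≤ seriesValue f t := by
  refine (summable_coeff_mul_pow hf (mem_khinchinDomain_of_le hs hst ht)).tsum_le_tsum
    (fun n => ?_) (summable_coeff_mul_pow hf ht)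
  have := hf.1 n
  gcongr

theorem khinchinMass_nonneg (hf : f ∈ khinchinClass) {t : ℝ} (ht : t ∈ khinchinDomain f) (n : ℕ) :
    0 ≤ khinchinMass f t n :=
  div_nonneg (mul_nonneg (hf.1 n) (pow_nonneg ht.1 n)) (seriesValue_pos hf ht).le

theorem hasSum_khinchinMass (hf : f ∈ khinchinClass) {t : ℝ} (ht : t ∈ khinchinDomain f) :
    HasSum (khinchinMass f t) 1 := by
  have := (summable_coeff_mul_pow hf ht).hasSum.div_const (seriesValue f t)
  rwa [← seriesValue, div_self (seriesValue_pos hf ht).ne'] at this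

theorem summable_pow_mul_khinchinMass (hf : f ∈ khinchinClass) {t : ℝ} (ht : t ∈ khinchinDomain f)
    (k : ℕ) : Summable fun n : ℕ => (n : ℝ) ^ k * khinchinMass f t n := by
  simpa only [khinchinMass, mul_div_assoc] using
    (summable_pow_mul_coeff hf ht k).div_const (seriesValue f t)

theorem hasSum_khinchinMean (hf : f ∈ khinchinClass) {t : ℝ} (ht : t ∈ khinchinDomain f) :
    HasSum (fun n : ℕ => (n : ℝ) * khinchinMass f t n) (khinchinMean f t) := by
  have := summable_pow_mul_khinchinMass hf ht 1
  simp only [pow_one] at this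
  exact this.hasSum

theorem khinchinMean_nonneg (hf : f ∈ khinchinClass) {t : ℝ} (ht : t ∈ khinchinDomain f) :
    0 ≤ khinchinMean f t :=
  tsum_nonneg fun n => mul_nonneg n.cast_nonneg (khinchinMass_nonneg hf ht n)

theorem khinchinMean_eq_div (f : PowerSeries ℝ) (t : ℝ) :
    khinchinMean f t = (∑' n : ℕ, (n : ℝ) * (PowerSeries.coeff n f * t ^ n)) / seriesValue f t := by
  rw [khinchinMean, ← tsum_div_const]
  simp only [khinchinMass, mul_div_assoc]

theorem khinchinMean_zero : khinchinMean f 0 = 0 := by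
  refine (tsum_congr fun n => ?_).trans tsum_zero
  rcases Nat.eq_zero_or_pos n with rfl | hn
  · simp
  · simp [khinchinMass, hn.ne']

theorem khinchinMean_pos (hf : f ∈ khinchinClass) {t : ℝ} (ht : t ∈ khinchinDomain f) (h0 : 0 < t) :
    0 < khinchinMean f t := by
  obtain ⟨n, hn, hne⟩ := hf.2.2.1
  refine (hasSum_khinchinMean hf ht).summable.tsum_pos
    (fun n => mul_nonneg n.cast_nonneg (khinchinMass_nonneg hf ht n)) n ?_
  have h1 : 0 < PowerSeries.coeff n f := (hf.1 n).lt_of_ne' hne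
  have h2 := seriesValue_pos hf ht
  have h3 : (0 : ℝ) < n := by exact_mod_cast hn
  unfold khinchinMass
  positivity

/-- The mean is strictly increasing. Passing from `s` to `t = r s` tilts the law of `X_s` by the
increasing weight `r ^ n`, and `(n - m) (r ^ n - r ^ m) ≥ 0` for every `n`, where `m` is the mean at
`s`. -/
theorem khinchinMean_strictMonoOn (hf : f ∈ khinchinClass) :
    StrictMonoOn (khinchinMean f) (khinchinDomain f) := by
  intro s hs t ht hst
  rcases hs.1.eq_or_lt with h0 | h0
  · rw [← h0, khinchinMean_zero]
    exact khinchinMean_pos hf ht (h0 ▸ hst)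
  set m := khinchinMean f s with hm
  have hm0 : 0 < m := khinchinMean_pos hf hs h0
  have hr : 1 < t / s := (one_lt_div h0).2 hst
  have hS0 := seriesValue_pos hf hs
  have hT0 := seriesValue_pos hf ht
  have hA : HasSum (fun n : ℕ => ((n : ℝ) - m) * (PowerSeries.coeff n f * s ^ n)) 0 := by
    have := ((hasSum_khinchinMean hf hs).sub ((hasSum_khinchinMass hf hs).mul_left m)).mul_left
      (seriesValue f s)
    rw [mul_one, sub_self, mul_zero] at this
    refine this.congr_fun fun n => ?_
    simp only [khinchinMass]
    field_simp
  have hB : HasSum (fun n : ℕ => ((n : ℝ) - m) * (PowerSeries.coeff n f * t ^ n))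
      (seriesValue f t * (khinchinMean f t - m)) := by
    have := ((hasSum_khinchinMean hf ht).sub ((hasSum_khinchinMass hf ht).mul_left m)).mul_left
      (seriesValue f t)
    rw [mul_one] at this
    refine this.congr_fun fun n => ?_
    simp only [khinchinMass]
    field_simp
  have hC := hB.sub (hA.mul_left ((t / s) ^ m))
  rw [mul_zero, sub_zero] at hC
  have hterm : ∀ n : ℕ, ((n : ℝ) - m) * (PowerSeries.coeff n f * t ^ n)
      - (t / s) ^ m * (((n : ℝ) - m) * (PowerSeries.coeff n f * s ^ n))
      = PowerSeries.coeff n f * s ^ n * (((n : ℝ) - m) * ((t / s) ^ (n : ℝ) - (t / s) ^ m)) := by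
    intro n
    rw [Real.rpow_natCast, div_pow]
    field_simp
  simp only [hterm] at hC
  have hnn : ∀ n : ℕ, 0 ≤
      PowerSeries.coeff n f * s ^ n * (((n : ℝ) - m) * ((t / s) ^ (n : ℝ) - (t / s) ^ m)) := by
    intro n
    refine mul_nonneg (mul_nonneg (hf.1 n) (pow_nonneg hs.1 n)) ?_
    rcases le_total (n : ℝ) m with h | h
    · exact mul_nonneg_of_nonpos_of_nonpos (by linarith)
        (by linarith [Real.rpow_le_rpow_of_exponent_le hr.le h])
    · exact mul_nonneg (by linarith) (by linarith [Real.rpow_le_rpow_of_exponent_le hr.le h])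
  have hpos : 0 < seriesValue f t * (khinchinMean f t - m) := by
    rw [← hC.tsum_eq]
    refine hC.summable.tsum_pos hnn 0 ?_
    have h1 : 1 < (t / s) ^ m := Real.one_lt_rpow hr hm0
    have h2 : 0 < PowerSeries.coeff 0 f := hf.2.1
    simp only [Nat.cast_zero, pow_zero, mul_one, zero_sub, Real.rpow_zero]
    exact mul_pos h2 (by nlinarith)
  exact sub_pos.1 (pos_of_mul_pos_right hpos hT0.le)

theorem continuousOn_tsum_pow_mul_coeff (hf : f ∈ khinchinClass) {b : ℝ}
    (hb : b ∈ khinchinDomain f) (k : ℕ) :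
    ContinuousOn (fun t : ℝ => ∑' n : ℕ, (n : ℝ) ^ k * (PowerSeries.coeff n f * t ^ n))
      (Set.Icc 0 b) := by
  refine continuousOn_tsum (fun n => by fun_prop) (summable_pow_mul_coeff hf hb k) fun n t ht => ?_
  have h1 := hf.1 n
  have h2 := ht.1
  rw [Real.norm_of_nonneg (by positivity)]
  have := ht.2
  gcongr

theorem continuousOn_khinchinMean (hf : f ∈ khinchinClass) {b : ℝ} (hb : b ∈ khinchinDomain f) :
    ContinuousOn (khinchinMean f) (Set.Icc 0 b) := by
  have h0 := continuousOn_tsum_pow_mul_coeff hf hb 0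
  have h1 := continuousOn_tsum_pow_mul_coeff hf hb 1
  simp only [pow_zero, one_mul, pow_one] at h0 h1
  refine (h1.div h0 fun t ht => ?_).congr fun t ht => ?_
  · exact (seriesValue_pos hf (mem_khinchinDomain_of_le ht.1 ht.2 hb)).ne'
  · exact khinchinMean_eq_div f t

/-- `M_f` is the supremum of the means; hence every number below `M_f` is exceeded by the mean at
some point of `[0, R)`. -/
theorem exists_lt_khinchinMean (hf : f ∈ khinchinClass) {B : ℝ}
    (hB : (B : EReal) < khinchinMeanLimit f) : ∃ b ∈ khinchinDomain f, B < khinchinMean f b := by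
  set l : Filter ℝ := comap (fun t : ℝ => (t : EReal)) (𝓝[<] (convergenceRadius f : EReal)) with hl
  have hR : (0 : EReal) < (convergenceRadius f : EReal) := by exact_mod_cast hf.2.2.2
  have hdom : ∀ t : ℝ, 0 ≤ t → (t : EReal) < (convergenceRadius f : EReal) →
      t ∈ khinchinDomain f := by
    intro t h0 h
    refine ⟨h0, ?_⟩
    rw [← EReal.coe_ennreal_lt_coe_ennreal_iff, EReal.coe_ennreal_ofReal, max_eq_left h0]
    exact h
  have hdom' : ∀ t : ℝ, t ∈ khinchinDomain f → (t : EReal) < (convergenceRadius f : EReal) := by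
    intro t ht
    have := ht.2
    rwa [← EReal.coe_ennreal_lt_coe_ennreal_iff, EReal.coe_ennreal_ofReal, max_eq_left ht.1] at this
  have hev : ∀ t ∈ khinchinDomain f, ∀ᶠ s in l, s ∈ khinchinDomain f ∧ t < s := by
    intro t ht
    have : ∀ᶠ x in 𝓝[<] (convergenceRadius f : EReal),
        (t : EReal) < x ∧ x < (convergenceRadius f : EReal) :=
      Ioo_mem_nhdsLT (hdom' t ht)
    filter_upwards [this.comap (fun t : ℝ => (t : EReal))] with s hs
    have hts : t < s := EReal.coe_lt_coe_iff.1 hs.1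
    exact ⟨hdom s (ht.1.trans hts.le) hs.2, hts⟩
  have hne : l.NeBot := by
    rw [hl, comap_neBot_iff]
    intro u hu
    obtain ⟨a, ha, hau⟩ := (mem_nhdsLT_iff_exists_Ioo_subset' hR).1 hu
    obtain ⟨x, hx1, hx2⟩ := EReal.lt_iff_exists_real_btwn.1 ha
    exact ⟨x, hau ⟨hx1, hx2⟩⟩
  have htend : Tendsto (fun t : ℝ => (khinchinMean f t : EReal)) l
      (𝓝 (⨆ t ∈ khinchinDomain f, (khinchinMean f t : EReal))) := by
    refine tendsto_order.2 ⟨fun y hy => ?_, fun y hy => ?_⟩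
    · obtain ⟨t, ht, hyt⟩ := lt_biSup_iff.1 hy
      filter_upwards [hev t ht] with s hs
      exact hyt.trans (EReal.coe_lt_coe_iff.2 (khinchinMean_strictMonoOn hf ht hs.1 hs.2))
    · filter_upwards [hev 0 (hdom 0 le_rfl hR)] with s hs
      exact (le_biSup (fun t => (khinchinMean f t : EReal)) hs.1).trans_lt hy
  rw [khinchinMeanLimit, htend.limUnder_eq] at hB
  obtain ⟨b, hb, h⟩ := lt_biSup_iff.1 hB
  exact ⟨b, hb, EReal.coe_lt_coe_iff.1 h⟩

theorem exists_khinchinMean_eq (hf : f ∈ khinchinClass) {b x : ℝ} (hb : b ∈ khinchinDomain f)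
    (h0 : 0 ≤ x) (hx : x ≤ khinchinMean f b) : ∃ t ∈ khinchinDomain f, khinchinMean f t = x := by
  obtain ⟨t, ht, h⟩ := intermediate_value_Icc hb.1 (continuousOn_khinchinMean hf hb)
    (show x ∈ Set.Icc (khinchinMean f 0) (khinchinMean f b) by rw [khinchinMean_zero]; exact ⟨h0, hx⟩)
  exact ⟨t, mem_khinchinDomain_of_le ht.1 ht.2 hb, h⟩

/-! ### The greatest common divisor of the support -/

/-- The supremum defining `Q_f` is attained, and it is the greatest common divisor also for the
order of divisibility. -/
theorem seriesGcd_spec (hf : f ∈ khinchinClass) :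
    0 < seriesGcd f ∧ (∀ n : ℕ, PowerSeries.coeff n f ≠ 0 → seriesGcd f ∣ n) ∧
      ∀ d : ℕ, (∀ n : ℕ, 1 ≤ n → PowerSeries.coeff n f ≠ 0 → d ∣ n) → d ∣ seriesGcd f := by
  set S : Set ℕ := {d : ℕ | ∀ n : ℕ, 1 ≤ n → PowerSeries.coeff n f ≠ 0 → d ∣ n} with hS
  obtain ⟨N, hN, hNe⟩ := hf.2.2.1
  have hbdd : BddAbove S := ⟨N, fun d hd => Nat.le_of_dvd hN (hd N hN hNe)⟩
  have h1 : 1 ∈ S := fun n _ _ => one_dvd n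
  have hmem : seriesGcd f ∈ S := Nat.sSup_mem ⟨1, h1⟩ hbdd
  have hpos : 0 < seriesGcd f := le_csSup hbdd h1
  refine ⟨hpos, fun n hn => ?_, fun d hd => ?_⟩
  · rcases Nat.eq_zero_or_pos n with rfl | h
    · exact dvd_zero _
    · exact hmem n h hn
  · -- The least common multiple is again a common divisor, hence not larger than the maximum.
    have hl : Nat.lcm d (seriesGcd f) ∈ S := fun n h1 h2 => Nat.lcm_dvd (hd n h1 h2) (hmem n h1 h2)
    have hle : Nat.lcm d (seriesGcd f) ≤ seriesGcd f := le_csSup hbdd hl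
    have heq := hle.antisymm
      (Nat.le_of_dvd (Nat.pos_of_ne_zero fun h => by
        rw [h] at hl
        exact absurd (Nat.eq_zero_of_zero_dvd (hl N hN hNe)) (by omega)) (Nat.dvd_lcm_right d _))
    exact heq ▸ Nat.dvd_lcm_left d _

end

/-! ### Laplace's method with a parameter -/

theorem norm_pow_sub_pow_le_mul {z w : ℂ} (hz : ‖z‖ ≤ 1) (hw : ‖w‖ ≤ 1) (n : ℕ) :
    ‖z ^ n - w ^ n‖ ≤ n * ‖z - w‖ := by
  induction n with
  | zero => simp
  | succ n ih =>
    have h : z ^ (n + 1) - w ^ (n + 1) = z ^ n * (z - w) + (z ^ n - w ^ n) * w := by ring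
    rw [h]
    refine (norm_add_le _ _).trans ?_
    rw [norm_mul, norm_mul, norm_pow]
    have h1 : ‖z‖ ^ n * ‖z - w‖ ≤ 1 * ‖z - w‖ := by
      gcongr
      exact pow_le_one₀ (norm_nonneg _) hz
    have h2 : ‖z ^ n - w ^ n‖ * ‖w‖ ≤ n * ‖z - w‖ * 1 := by gcongr
    push_cast
    linarith

theorem abs_exp_neg_sub_one_sub_le {y : ℝ} (hy : 0 ≤ y) : |Real.exp (-y) - (1 - y)| ≤ y ^ 2 := by
  have h1 : 1 - y ≤ Real.exp (-y) := by linarith [Real.add_one_le_exp (-y)]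
  have h2 : Real.exp (-y) * (1 + y) ≤ 1 := by
    calc Real.exp (-y) * (1 + y) ≤ Real.exp (-y) * Real.exp y := by
          gcongr
          linarith [Real.add_one_le_exp y]
      _ = 1 := by rw [← Real.exp_add]; simp
  have h3 : 0 < Real.exp (-y) := Real.exp_pos _
  rw [abs_of_nonneg (by linarith)]
  by_contra! h
  nlinarith [mul_nonneg hy (sq_nonneg y)]

/-- The second order Taylor bound for `exp (i x)`, valid on the whole real line. -/
theorem norm_exp_mul_I_sub_taylor_le (x : ℝ) :
    ‖Complex.exp (x * Complex.I) - (1 + x * Complex.I - x ^ 2 / 2)‖ ≤ 4 * |x| ^ 3 := by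
  have hn : ‖(x : ℂ) * Complex.I‖ = |x| := by simp
  rcases le_total |x| 1 with h | h
  · have := Complex.exp_bound (x := (x : ℂ) * Complex.I) (by rw [hn]; exact h) (n := 3) (by norm_num)
    rw [hn] at this
    have e : ∑ m ∈ Finset.range 3, ((x : ℂ) * Complex.I) ^ m / (m.factorial : ℂ)
        = 1 + x * Complex.I - x ^ 2 / 2 := by
      simp [Finset.sum_range_succ, mul_pow]
      ring
    rw [e] at this
    refine this.trans ?_
    have h3 : 0 ≤ |x| ^ 3 := by positivity
    norm_num [Nat.factorial]
    nlinarith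
  · have h1 : ‖Complex.exp (x * Complex.I)‖ = 1 := Complex.norm_exp_ofReal_mul_I x
    have h2 : ‖(1 : ℂ) + x * Complex.I - x ^ 2 / 2‖ ≤ 1 + |x| + |x| ^ 2 / 2 := by
      refine (norm_sub_le _ _).trans (add_le_add ((norm_add_le _ _).trans ?_) ?_)
      · simp
      · simp
    refine (norm_sub_le _ _).trans ?_
    rw [h1]
    have h4 : |x| ≤ |x| ^ 3 := le_self_pow₀ h (by norm_num)
    have h5 : |x| ^ 2 ≤ |x| ^ 3 := pow_le_pow_right₀ h (by norm_num)
    linarith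

/-- A function `g` with the expansion `1 - v θ² / 2 + O(θ³)` is close to the Gaussian after
rescaling: the error is explicit in `N` and in the constant `C`. -/
theorem norm_rescaled_pow_sub_gaussian_le {g : ℝ → ℂ} {v C u : ℝ} {N : ℕ} (hN : 1 ≤ N)
    (hv : 0 ≤ v) (hvC : v ≤ C) (hg1 : ‖g (u / √N)‖ ≤ 1)
    (hg : ∀ θ : ℝ, ‖g θ - (1 - v * θ ^ 2 / 2 : ℝ)‖ ≤ C * |θ| ^ 3) :
    ‖g (u / √N) ^ N - (Real.exp (-(v / 2) * u ^ 2) : ℝ)‖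
      ≤ C * |u| ^ 3 / √N + (C / 2 * u ^ 2) ^ 2 / N := by
  have hN0 : (0 : ℝ) < N := by exact_mod_cast hN
  have hs : 0 < √(N : ℝ) := Real.sqrt_pos.2 hN0
  have hss : √(N : ℝ) ^ 2 = N := Real.sq_sqrt hN0.le
  set y : ℝ := v * (u / √N) ^ 2 / 2 with hy
  have hy0 : 0 ≤ y := by positivity
  have hyN : y = v / 2 * u ^ 2 / N := by rw [hy, div_pow, hss]; ring
  have hexp : Real.exp (-(v / 2) * u ^ 2) = Real.exp (-y) ^ N := by
    rw [← Real.exp_nat_mul, hyN]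
    congr 1
    field_simp
  rw [hexp]
  push_cast
  have hw1 : ‖(Complex.exp (-(y : ℂ)))‖ ≤ 1 := by
    rw [← Complex.ofReal_neg, ← Complex.ofReal_exp, Complex.norm_real,
      Real.norm_of_nonneg (Real.exp_pos _).le]
    exact Real.exp_le_one_iff.2 (by linarith)
  refine (norm_pow_sub_pow_le_mul hg1 hw1 N).trans ?_
  have hd : ‖g (u / √N) - Complex.exp (-(y : ℂ))‖ ≤ C * |u / √N| ^ 3 + y ^ 2 := by
    have h1 := hg (u / √N)
    have h2 : ‖((1 - y : ℝ) : ℂ) - Complex.exp (-(y : ℂ))‖ ≤ y ^ 2 := by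
      rw [← Complex.ofReal_neg, ← Complex.ofReal_exp, ← Complex.ofReal_sub, Complex.norm_real,
        Real.norm_eq_abs, abs_sub_comm]
      exact abs_exp_neg_sub_one_sub_le hy0
    exact (norm_sub_le_norm_sub_add_norm_sub _ _ _).trans (add_le_add h1 h2)
  calc (N : ℝ) * ‖g (u / √N) - Complex.exp (-(y : ℂ))‖
      ≤ N * (C * |u / √N| ^ 3 + y ^ 2) := by gcongr
    _ = C * |u| ^ 3 / √N + (v / 2 * u ^ 2) ^ 2 / N := by
        rw [hyN, abs_div, abs_of_pos hs, div_pow, show √(N : ℝ) ^ 3 = N * √N by rw [pow_succ, hss]]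
        field_simp
    _ ≤ _ := by gcongr

/-- **Laplace's method, uniformly in a parameter.** If `g i θ = 1 - v i θ² / 2 + O(θ³)` and
`‖g i θ‖ ≤ exp (-c θ²)` on `[-L, L]`, with `v i` in a compact subset of `(0, ∞)` and constants that
do not depend on `i`, then `∫ g i ^ N` over `[-L, L]` is asymptotic to `√(2π / (N v i))`. -/
theorem tendsto_sqrt_mul_integral_pow {ι : Type*} {l : Filter ι} [l.IsCountablyGenerated]
    {N : ι → ℕ} (hN : Tendsto N l atTop) {g : ι → ℝ → ℂ} {v : ι → ℝ} {c s C L : ℝ}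
    (hc : 0 < c) (hs : 0 < s) (hL : 0 < L)
    (hcont : ∀ᶠ i in l, Continuous (g i))
    (hsv : ∀ᶠ i in l, s ≤ v i) (hvC : ∀ᶠ i in l, v i ≤ C)
    (hdecay : ∀ᶠ i in l, ∀ θ : ℝ, |θ| ≤ L → ‖g i θ‖ ≤ Real.exp (-c * θ ^ 2))
    (htaylor : ∀ᶠ i in l, ∀ θ : ℝ, ‖g i θ - (1 - v i * θ ^ 2 / 2 : ℝ)‖ ≤ C * |θ| ^ 3) :
    Tendsto (fun i => ((√(N i : ℝ) * √(v i) : ℝ) : ℂ) * ∫ θ in (-L)..L, g i θ ^ N i) l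
      (𝓝 ((√(2 * Real.pi) : ℝ) : ℂ)) := by
  have hNR : Tendsto (fun i => (N i : ℝ)) l atTop := tendsto_natCast_atTop_atTop.comp hN
  have hNS : Tendsto (fun i => √(N i : ℝ)) l atTop := Real.tendsto_sqrt_atTop.comp hNR
  -- The rescaled integrand, cut off to the range of integration.
  set F : ι → ℝ → ℂ := fun i u =>
    (Set.Ioc (-(L * √(N i : ℝ))) (L * √(N i : ℝ))).indicator (fun u => g i (u / √(N i : ℝ)) ^ N i) u
    with hF
  have hFint : ∀ᶠ i in l, (∫ u, F i u) = (√(N i : ℝ) : ℂ) * ∫ θ in (-L)..L, g i θ ^ N i := by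
    filter_upwards [hN.eventually_ge_atTop 1] with i hi
    have hpos : 0 < √(N i : ℝ) := Real.sqrt_pos.2 (by exact_mod_cast hi)
    rw [hF]
    simp only
    rw [MeasureTheory.integral_indicator measurableSet_Ioc,
      ← intervalIntegral.integral_of_le (by nlinarith),
      intervalIntegral.integral_comp_div (fun θ => g i θ ^ N i) hpos.ne', neg_div,
      mul_div_cancel_right₀ _ hpos.ne', Complex.real_smul]
  have hFbound : ∀ᶠ i in l, ∀ u, ‖F i u‖ ≤ Real.exp (-c * u ^ 2) := by
    filter_upwards [hN.eventually_ge_atTop 1, hdecay] with i hi hd u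
    have hN0 : (0 : ℝ) < N i := by exact_mod_cast hi
    have hpos : 0 < √(N i : ℝ) := Real.sqrt_pos.2 hN0
    rw [hF]
    simp only [Set.indicator]
    split_ifs with h
    · rw [norm_pow]
      have h1 : |u / √(N i : ℝ)| ≤ L := by
        rw [abs_div, abs_of_pos hpos, div_le_iff₀ hpos, abs_le]
        exact ⟨h.1.le, h.2⟩
      calc ‖g i (u / √(N i : ℝ))‖ ^ N i ≤ Real.exp (-c * (u / √(N i : ℝ)) ^ 2) ^ N i := by
            gcongr
            exact hd _ h1
        _ = Real.exp (-c * u ^ 2) := by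
            rw [← Real.exp_nat_mul, div_pow, Real.sq_sqrt hN0.le]
            congr 1
            field_simp
    · simpa using (Real.exp_pos _).le
  have hEbound : ∀ᶠ i in l, ∀ u : ℝ,
      ‖((Real.exp (-(v i / 2) * u ^ 2) : ℝ) : ℂ)‖ ≤ Real.exp (-(s / 2) * u ^ 2) := by
    filter_upwards [hsv] with i hi u
    rw [Complex.norm_real, Real.norm_of_nonneg (Real.exp_pos _).le]
    gcongr
  have hFmeas : ∀ᶠ i in l, MeasureTheory.AEStronglyMeasurable (F i) MeasureTheory.volume := by
    filter_upwards [hcont] with i hi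
    refine MeasureTheory.AEStronglyMeasurable.indicator ?_ measurableSet_Ioc
    exact Continuous.aestronglyMeasurable (by fun_prop)
  -- The variance `v i` need not converge, so the difference with the Gaussian is what tends to zero.
  have hlim : Tendsto (fun i => ∫ u, (F i u - (Real.exp (-(v i / 2) * u ^ 2) : ℝ))) l
      (𝓝 (∫ _ : ℝ, (0 : ℂ))) := by
    refine MeasureTheory.tendsto_integral_filter_of_dominated_convergence
      (fun u => Real.exp (-c * u ^ 2) + Real.exp (-(s / 2) * u ^ 2)) ?_ ?_ ?_ ?_
    · filter_upwards [hFmeas] with i hi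
      exact hi.sub (Continuous.aestronglyMeasurable (by fun_prop))
    · filter_upwards [hFbound, hEbound] with i h1 h2
      exact Eventually.of_forall fun u => (norm_sub_le _ _).trans (add_le_add (h1 u) (h2 u))
    · exact (integrable_exp_neg_mul_sq hc).add (integrable_exp_neg_mul_sq (by positivity))
    · refine Eventually.of_forall fun u => ?_
      have hz : Tendsto (fun i => C * |u| ^ 3 / √(N i : ℝ) + (C / 2 * u ^ 2) ^ 2 / N i) l (𝓝 0) := by
        simpa using (tendsto_const_nhds.div_atTop hNS).add (tendsto_const_nhds.div_atTop hNR)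
      refine squeeze_zero_norm' ?_ hz
      filter_upwards [hN.eventually_ge_atTop 1, hdecay, htaylor, hsv, hvC,
        hNS.eventually_gt_atTop (|u| / L)] with i hi hd ht h1 h2 h3
      have hN0 : (0 : ℝ) < N i := by exact_mod_cast hi
      have hpos : 0 < √(N i : ℝ) := Real.sqrt_pos.2 hN0
      have hu : |u| < L * √(N i : ℝ) := by rwa [div_lt_iff₀' hL] at h3
      have hmem : u ∈ Set.Ioc (-(L * √(N i : ℝ))) (L * √(N i : ℝ)) :=
        ⟨(abs_lt.1 hu).1, (abs_lt.1 hu).2.le⟩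
      rw [hF]
      simp only [Set.indicator_of_mem hmem]
      refine norm_rescaled_pow_sub_gaussian_le hi (hs.le.trans h1) h2 ?_ ht
      refine (hd _ ?_).trans (Real.exp_le_one_iff.2 (by nlinarith [sq_nonneg (u / √(N i : ℝ))]))
      rw [abs_div, abs_of_pos hpos, div_le_iff₀ hpos]
      exact hu.le
  rw [MeasureTheory.integral_zero] at hlim
  have hb : ∀ᶠ i in l, ‖(√(v i) : ℂ)‖ ≤ √C := by
    filter_upwards [hvC] with i hi
    rw [Complex.norm_real, Real.norm_of_nonneg (Real.sqrt_nonneg _)]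
    exact Real.sqrt_le_sqrt hi
  have hmul : Tendsto (fun i => (√(v i) : ℂ) *
      ∫ u, (F i u - (Real.exp (-(v i / 2) * u ^ 2) : ℝ))) l (𝓝 0) := by
    simpa only [mul_comm] using
      hlim.zero_mul_isBoundedUnder_le (isBoundedUnder_of_eventually_le hb)
  have hfin := hmul.add_const ((√(2 * Real.pi) : ℝ) : ℂ)
  rw [zero_add] at hfin
  refine hfin.congr' ?_
  filter_upwards [hFint, hFbound, hFmeas, hsv] with i h1 h2 h3 h4
  have hv : 0 < v i := hs.trans_le h4
  have hI1 : MeasureTheory.Integrable (F i) :=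
    (integrable_exp_neg_mul_sq hc).mono' h3 (Eventually.of_forall h2)
  have hI2 : MeasureTheory.Integrable (fun u : ℝ => ((Real.exp (-(v i / 2) * u ^ 2) : ℝ) : ℂ)) :=
    (integrable_exp_neg_mul_sq (by positivity)).ofReal
  rw [MeasureTheory.integral_sub hI1 hI2, h1, integral_complex_ofReal, integral_gaussian, mul_sub,
    ← Complex.ofReal_mul, ← Real.sqrt_mul hv.le,
    show v i * (Real.pi / (v i / 2)) = 2 * Real.pi by field_simp]
  push_cast
  ring

section

variable {f : PowerSeries ℝ}

/-! ### The centred characteristic function -/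

/-- The characteristic function `θ ↦ E (exp (i θ (X_t - m(t))))` of the centred variable of the
Khinchin family of `f`. -/
noncomputable def centredCharFun (f : PowerSeries ℝ) (t θ : ℝ) : ℂ :=
  ∑' n : ℕ, (khinchinMass f t n : ℂ) *
    Complex.exp ((((n : ℝ) - khinchinMean f t) * θ : ℝ) * Complex.I)

theorem norm_mass_mul_exp (hf : f ∈ khinchinClass) {t : ℝ} (ht : t ∈ khinchinDomain f) (n : ℕ)
    (x : ℝ) : ‖(khinchinMass f t n : ℂ) * Complex.exp (x * Complex.I)‖ = khinchinMass f t n := by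
  rw [norm_mul, Complex.norm_exp_ofReal_mul_I, mul_one, Complex.norm_real,
    Real.norm_of_nonneg (khinchinMass_nonneg hf ht n)]

theorem hasSum_centredCharFun (hf : f ∈ khinchinClass) {t : ℝ} (ht : t ∈ khinchinDomain f) (θ : ℝ) :
    HasSum (fun n : ℕ => (khinchinMass f t n : ℂ) *
      Complex.exp ((((n : ℝ) - khinchinMean f t) * θ : ℝ) * Complex.I)) (centredCharFun f t θ) := by
  refine Summable.hasSum (Summable.of_norm ?_)
  simp only [norm_mass_mul_exp hf ht]
  exact (hasSum_khinchinMass hf ht).summable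

theorem continuous_centredCharFun (hf : f ∈ khinchinClass) {t : ℝ} (ht : t ∈ khinchinDomain f) :
    Continuous (centredCharFun f t) := by
  refine continuous_tsum (fun n => by fun_prop) (hasSum_khinchinMass hf ht).summable fun n θ => ?_
  exact (norm_mass_mul_exp hf ht n _).le

/-! ### Decay of the characteristic function on a period -/

theorem one_sub_cos_add_le (x y : ℝ) :
    1 - Real.cos (x + y) ≤ 2 * (1 - Real.cos x) + 2 * (1 - Real.cos y) := by
  have half : ∀ z : ℝ, 1 - Real.cos z = 2 * Real.sin (z / 2) ^ 2 := by
    intro z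
    have := Real.cos_two_mul (z / 2)
    rw [mul_div_cancel₀ z two_ne_zero] at this
    nlinarith [Real.sin_sq_add_cos_sq (z / 2)]
  rw [half, half, half, add_div, Real.sin_add]
  set a := Real.sin (x / 2)
  set b := Real.sin (y / 2)
  have h1 := Real.sin_sq_add_cos_sq (x / 2)
  have h2 := Real.sin_sq_add_cos_sq (y / 2)
  have h3 : (a * Real.cos (y / 2)) ^ 2 ≤ a ^ 2 := by
    rw [mul_pow]
    exact mul_le_of_le_one_right (sq_nonneg _) (Real.cos_sq_le_one _)
  have h4 : (Real.cos (x / 2) * b) ^ 2 ≤ b ^ 2 := by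
    rw [mul_pow]
    exact mul_le_of_le_one_left (sq_nonneg _) (Real.cos_sq_le_one _)
  nlinarith [sq_nonneg (a * Real.cos (y / 2) - Real.cos (x / 2) * b)]

/-- If the characteristic function is nearly of modulus `1` at `θ`, then `exp (i n θ)` is nearly
`1` for all `n` in the support: with `α` the argument of the characteristic function,
`1 - ‖φ(θ)‖ = E (1 - cos ((X - m) θ - α))`, and one compares the terms `0` and `n`. -/
theorem mass_mul_one_sub_cos_le (hf : f ∈ khinchinClass) {t : ℝ} (ht : t ∈ khinchinDomain f)
    (θ : ℝ) (n : ℕ) :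
    khinchinMass f t 0 * khinchinMass f t n * (1 - Real.cos (n * θ))
      ≤ 2 * (1 - ‖centredCharFun f t θ‖) := by
  set m := khinchinMean f t
  set α := (centredCharFun f t θ).arg with hα
  have hp := khinchinMass_nonneg hf ht
  have hp1 : ∀ n, khinchinMass f t n ≤ 1 := fun n =>
    le_hasSum (hasSum_khinchinMass hf ht) n fun k _ => hp k
  have hsum : HasSum (fun n : ℕ => khinchinMass f t n * (1 - Real.cos (((n : ℝ) - m) * θ - α)))
      (1 - ‖centredCharFun f t θ‖) := by
    have h1 := (hasSum_centredCharFun hf ht θ).mul_right (Complex.exp ((-α : ℝ) * Complex.I))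
    have h2 : centredCharFun f t θ * Complex.exp ((-α : ℝ) * Complex.I)
        = (‖centredCharFun f t θ‖ : ℂ) := by
      conv_lhs => rw [← Complex.norm_mul_exp_arg_mul_I (centredCharFun f t θ), ← hα, mul_assoc,
        ← Complex.exp_add]
      simp
    rw [h2] at h1
    have h3 := Complex.hasSum_re h1
    rw [Complex.ofReal_re] at h3
    refine ((hasSum_khinchinMass hf ht).sub h3).congr_fun fun n => ?_
    rw [mul_assoc, ← Complex.exp_add, ← add_mul, ← Complex.ofReal_add, Complex.re_ofReal_mul,
      Complex.exp_ofReal_mul_I_re, ← sub_eq_add_neg]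
    ring
  have hnn : ∀ n : ℕ, 0 ≤ khinchinMass f t n * (1 - Real.cos (((n : ℝ) - m) * θ - α)) := fun n =>
    mul_nonneg (hp n) (by linarith [Real.cos_le_one (((n : ℝ) - m) * θ - α)])
  rcases Nat.eq_zero_or_pos n with rfl | hn
  · have := hsum.nonneg hnn
    simpa using this
  · have hpair := sum_le_hasSum {0, n} (fun k _ => hnn k) hsum
    rw [Finset.sum_pair hn.ne] at hpair
    have hcos := one_sub_cos_add_le (((n : ℝ) - m) * θ - α) (-((((0 : ℕ) : ℝ) - m) * θ - α))
    rw [Real.cos_neg, show ((n : ℝ) - m) * θ - α + -((((0 : ℕ) : ℝ) - m) * θ - α) = n * θ by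
      push_cast; ring] at hcos
    have e0 := hnn 0
    have e1 := hnn n
    calc khinchinMass f t 0 * khinchinMass f t n * (1 - Real.cos (n * θ))
        ≤ khinchinMass f t 0 * khinchinMass f t n * (2 * (1 - Real.cos (((n : ℝ) - m) * θ - α))
            + 2 * (1 - Real.cos ((((0 : ℕ) : ℝ) - m) * θ - α))) :=
          mul_le_mul_of_nonneg_left hcos (mul_nonneg (hp 0) (hp n))
      _ = 2 * (khinchinMass f t 0 * (khinchinMass f t n * (1 - Real.cos (((n : ℝ) - m) * θ - α)))
            + khinchinMass f t n *
              (khinchinMass f t 0 * (1 - Real.cos ((((0 : ℕ) : ℝ) - m) * θ - α)))) := by ring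
      _ ≤ 2 * (1 * (khinchinMass f t n * (1 - Real.cos (((n : ℝ) - m) * θ - α)))
            + 1 * (khinchinMass f t 0 * (1 - Real.cos ((((0 : ℕ) : ℝ) - m) * θ - α)))) := by
          gcongr
          · exact hp1 0
          · exact hp1 n
      _ ≤ 2 * (1 - ‖centredCharFun f t θ‖) := by linarith

theorem coeff_mul_pow_div_le_khinchinMass (hf : f ∈ khinchinClass) {a b t : ℝ} (ha : 0 ≤ a)
    (hb : b ∈ khinchinDomain f) (ht : t ∈ Set.Icc a b) (n : ℕ) :
    PowerSeries.coeff n f * a ^ n / seriesValue f b ≤ khinchinMass f t n := by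
  have h0 : 0 ≤ t := ha.trans ht.1
  have h1 := hf.1 n
  have h2 := seriesValue_le_seriesValue hf h0 ht.2 hb
  have h3 := seriesValue_pos hf (mem_khinchinDomain_of_le h0 ht.2 hb)
  have h4 := ht.1
  unfold khinchinMass
  gcongr

/-- The integers `g` for which `1 - cos (g θ)` is controlled by `1 - ‖φ_t(θ)‖`, uniformly in
`t ∈ [a, b]` and `θ`, form a subgroup of `ℤ`. It contains the support of the coefficients, hence
the greatest common divisor `Q_f`. -/
theorem exists_one_sub_cos_seriesGcd_le (hf : f ∈ khinchinClass) {a b : ℝ} (ha : 0 < a)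
    (hb : b ∈ khinchinDomain f) :
    ∃ C : ℝ, 0 < C ∧ ∀ t ∈ Set.Icc a b, ∀ θ : ℝ,
      1 - Real.cos (seriesGcd f * θ) ≤ C * (1 - ‖centredCharFun f t θ‖) := by
  let H : AddSubgroup ℤ :=
    { carrier := {g | ∃ C : ℝ, ∀ t ∈ Set.Icc a b, ∀ θ : ℝ,
        1 - Real.cos (g * θ) ≤ C * (1 - ‖centredCharFun f t θ‖)}
      zero_mem' := ⟨0, fun t _ θ => by simp⟩
      add_mem' := by
        rintro g h ⟨C, hC⟩ ⟨D, hD⟩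
        refine ⟨2 * C + 2 * D, fun t ht θ => ?_⟩
        have h1 := one_sub_cos_add_le (g * θ) (h * θ)
        have h2 := hC t ht θ
        have h3 := hD t ht θ
        push_cast
        rw [add_mul]
        linarith
      neg_mem' := by
        rintro g ⟨C, hC⟩
        refine ⟨C, fun t ht θ => ?_⟩
        have := hC t ht θ
        push_cast
        rwa [neg_mul, Real.cos_neg] }
  have hsupp : ∀ n : ℕ, PowerSeries.coeff n f ≠ 0 → (n : ℤ) ∈ H := by
    intro n hn
    have hS := seriesValue_pos hf hb
    have h0 : 0 < PowerSeries.coeff 0 f := hf.2.1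
    have h1 : 0 < PowerSeries.coeff n f := (hf.1 n).lt_of_ne' hn
    set P := PowerSeries.coeff 0 f * a ^ 0 / seriesValue f b with hP
    set P' := PowerSeries.coeff n f * a ^ n / seriesValue f b with hP'
    have hP0 : 0 < P := by positivity
    have hP0' : 0 < P' := by positivity
    refine ⟨2 / (P * P'), fun t ht θ => ?_⟩
    have h2 := coeff_mul_pow_div_le_khinchinMass hf ha.le hb ht 0
    have h3 := coeff_mul_pow_div_le_khinchinMass hf ha.le hb ht n
    have h4 := mass_mul_one_sub_cos_le hf
      (mem_khinchinDomain_of_le (ha.le.trans ht.1) ht.2 hb) θ n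
    have h5 : 0 ≤ 1 - Real.cos (n * θ) := by linarith [Real.cos_le_one (n * θ)]
    have h6 : P * P' ≤ khinchinMass f t 0 * khinchinMass f t n :=
      mul_le_mul h2 h3 hP0'.le (hP0.le.trans h2)
    rw [div_mul_eq_mul_div, le_div_iff₀ (by positivity), mul_comm]
    push_cast
    exact (mul_le_mul_of_nonneg_right h6 h5).trans h4
  obtain ⟨d, hd⟩ := Int.subgroup_cyclic H
  have hdvd : ∀ g : ℤ, g ∈ H ↔ d ∣ g := fun g => by
    rw [hd, ← AddSubgroup.zmultiples_eq_closure, Int.mem_zmultiples_iff]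
  have hQ : ((seriesGcd f : ℕ) : ℤ) ∈ H := by
    rw [hdvd, ← Int.natAbs_dvd, Int.natCast_dvd_natCast]
    refine (seriesGcd_spec hf).2.2 _ fun n _ hn => ?_
    rw [← Int.natCast_dvd_natCast, Int.natAbs_dvd]
    exact (hdvd _).1 (hsupp n hn)
  obtain ⟨C, hC⟩ := hQ
  refine ⟨|C| + 1, by positivity, fun t ht θ => ?_⟩
  have htd := mem_khinchinDomain_of_le (ha.le.trans ht.1) ht.2 hb
  have h1 : 0 ≤ 1 - ‖centredCharFun f t θ‖ := by
    have := mass_mul_one_sub_cos_le hf htd θ 0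
    simp only [Nat.cast_zero, zero_mul, Real.cos_zero, sub_self, mul_zero] at this
    linarith
  have h2 := hC t ht θ
  push_cast at h2
  exact h2.trans (mul_le_mul_of_nonneg_right (by linarith [le_abs_self C]) h1)

/-- Gaussian decay of the characteristic functions on a period, uniformly for `t ∈ [a, b]`. -/
theorem exists_norm_centredCharFun_le (hf : f ∈ khinchinClass) {a b : ℝ} (ha : 0 < a)
    (hb : b ∈ khinchinDomain f) :
    ∃ c : ℝ, 0 < c ∧ ∀ t ∈ Set.Icc a b, ∀ θ : ℝ, |θ| ≤ Real.pi / seriesGcd f →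
      ‖centredCharFun f t θ‖ ≤ Real.exp (-c * θ ^ 2) := by
  obtain ⟨C, hC0, hC⟩ := exists_one_sub_cos_seriesGcd_le hf ha hb
  have hQ : (0 : ℝ) < seriesGcd f := by exact_mod_cast (seriesGcd_spec hf).1
  refine ⟨2 / Real.pi ^ 2 * seriesGcd f ^ 2 / C, by positivity, fun t ht θ hθ => ?_⟩
  have h1 : |seriesGcd f * θ| ≤ Real.pi := by
    rw [abs_mul, abs_of_pos hQ, mul_comm]
    exact (le_div_iff₀ hQ).1 hθ
  have h2 := Real.cos_le_one_sub_mul_cos_sq h1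
  have h3 := hC t ht θ
  have h4 : 2 / Real.pi ^ 2 * seriesGcd f ^ 2 / C * θ ^ 2 ≤ 1 - ‖centredCharFun f t θ‖ := by
    rw [div_mul_eq_mul_div, div_le_iff₀ hC0]
    nlinarith
  have h5 := Real.add_one_le_exp (-(2 / Real.pi ^ 2 * seriesGcd f ^ 2 / C) * θ ^ 2)
  linarith

/-! ### Taylor expansion of the characteristic function -/

theorem summable_succ_cube_mul_coeff (hf : f ∈ khinchinClass) {t : ℝ} (ht : t ∈ khinchinDomain f) :
    Summable fun n : ℕ => ((n : ℝ) + 1) ^ 3 * (PowerSeries.coeff n f * t ^ n) := by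
  have h := (((summable_pow_mul_coeff hf ht 3).add ((summable_pow_mul_coeff hf ht 2).mul_left 3)).add
    ((summable_pow_mul_coeff hf ht 1).mul_left 3)).add (summable_pow_mul_coeff hf ht 0)
  refine h.congr fun n => ?_
  ring

/-- The moments of the centred variable up to order three are bounded uniformly for `t ∈ [0, b]`. -/
theorem exists_centred_moment_bound (hf : f ∈ khinchinClass) {b : ℝ} (hb : b ∈ khinchinDomain f) :
    ∃ K : ℝ, ∀ t ∈ Set.Icc 0 b, ∀ j ≤ 3,
      (Summable fun n : ℕ => |(n : ℝ) - khinchinMean f t| ^ j * khinchinMass f t n) ∧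
      ∑' n : ℕ, |(n : ℝ) - khinchinMean f t| ^ j * khinchinMass f t n ≤ K := by
  -- As `0 ≤ m(t) ≤ M`, one has `|n - m(t)| ≤ (1 + M) (n + 1)`, and `f(t) ≥ a₀`; both bounds are
  -- free of `t`.
  set M := khinchinMean f b
  have hM : 0 ≤ M := khinchinMean_nonneg hf hb
  have hsum := ((summable_succ_cube_mul_coeff hf hb).mul_left ((1 + M) ^ 3)).div_const
    (PowerSeries.coeff 0 f)
  refine ⟨∑' n : ℕ, (1 + M) ^ 3 * (((n : ℝ) + 1) ^ 3 * (PowerSeries.coeff n f * b ^ n))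
    / PowerSeries.coeff 0 f, fun t ht j hj => ?_⟩
  have htd := mem_khinchinDomain_of_le ht.1 ht.2 hb
  have hm0 := khinchinMean_nonneg hf htd
  have hmM : khinchinMean f t ≤ M := (khinchinMean_strictMonoOn hf).monotoneOn htd hb ht.2
  have hle : ∀ n : ℕ, |(n : ℝ) - khinchinMean f t| ^ j * khinchinMass f t n
      ≤ (1 + M) ^ 3 * (((n : ℝ) + 1) ^ 3 * (PowerSeries.coeff n f * b ^ n))
        / PowerSeries.coeff 0 f := by
    intro n
    have hn : (0 : ℝ) ≤ n := n.cast_nonneg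
    have h1 : |(n : ℝ) - khinchinMean f t| ≤ (1 + M) * (n + 1) := by
      rw [abs_le]
      constructor <;> nlinarith [mul_nonneg hM hn]
    have h2 : |(n : ℝ) - khinchinMean f t| ^ j ≤ ((1 + M) * (n + 1)) ^ 3 :=
      (pow_le_pow_left₀ (abs_nonneg _) h1 j).trans
        (pow_le_pow_right₀ (by nlinarith [mul_nonneg hM hn]) hj)
    have h3 : khinchinMass f t n ≤ PowerSeries.coeff n f * b ^ n / PowerSeries.coeff 0 f := by
      have e1 := hf.1 n
      have e2 := ht.1
      have e3 := ht.2
      have e4 : 0 < PowerSeries.coeff 0 f := hf.2.1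
      have e5 := coeff_zero_le_seriesValue hf htd
      have e6 := hb.1
      unfold khinchinMass
      gcongr
    calc _ ≤ ((1 + M) * (n + 1)) ^ 3 * (PowerSeries.coeff n f * b ^ n / PowerSeries.coeff 0 f) :=
          mul_le_mul h2 h3 (khinchinMass_nonneg hf htd n) (by positivity)
      _ = _ := by ring
  have hs : Summable fun n : ℕ => |(n : ℝ) - khinchinMean f t| ^ j * khinchinMass f t n :=
    Summable.of_nonneg_of_le
      (fun n => mul_nonneg (pow_nonneg (abs_nonneg _) j) (khinchinMass_nonneg hf htd n)) hle hsum
  exact ⟨hs, hs.tsum_le_tsum hle hsum⟩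

/-- Second order Taylor expansion of the characteristic function, with the third absolute moment
in the error term. -/
theorem norm_centredCharFun_sub_le (hf : f ∈ khinchinClass) {t K : ℝ} (ht : t ∈ khinchinDomain f)
    (hK : ∀ j ≤ 3, (Summable fun n : ℕ => |(n : ℝ) - khinchinMean f t| ^ j * khinchinMass f t n) ∧
      ∑' n : ℕ, |(n : ℝ) - khinchinMean f t| ^ j * khinchinMass f t n ≤ K) (θ : ℝ) :
    ‖centredCharFun f t θ - (1 - khinchinVariance f t * θ ^ 2 / 2 : ℝ)‖ ≤ 4 * K * |θ| ^ 3 := by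
  set m := khinchinMean f t
  have h0 := hasSum_khinchinMass hf ht
  have h1 : HasSum (fun n : ℕ => ((n : ℝ) - m) * khinchinMass f t n) 0 := by
    have := (hasSum_khinchinMean hf ht).sub (h0.mul_left m)
    rw [mul_one, sub_self] at this
    exact this.congr_fun fun n => by ring
  have h2 : HasSum (fun n : ℕ => ((n : ℝ) - m) ^ 2 * khinchinMass f t n) (khinchinVariance f t) := by
    have := (hK 2 (by norm_num)).1
    simp only [sq_abs] at this
    exact this.hasSum
  have h3 := hK 3 le_rfl
  have hpoly := ((Complex.hasSum_ofReal.2 h0).add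
    ((Complex.hasSum_ofReal.2 h1).mul_left (θ * Complex.I))).sub
      ((Complex.hasSum_ofReal.2 h2).mul_left ((θ : ℂ) ^ 2 / 2))
  have hdiff := (hasSum_centredCharFun hf ht θ).sub hpoly
  have hterm : ∀ n : ℕ, ‖(khinchinMass f t n : ℂ) *
        Complex.exp ((((n : ℝ) - m) * θ : ℝ) * Complex.I) -
      ((khinchinMass f t n : ℂ) + θ * Complex.I * ((((n : ℝ) - m) * khinchinMass f t n : ℝ) : ℂ)
        - (θ : ℂ) ^ 2 / 2 * ((((n : ℝ) - m) ^ 2 * khinchinMass f t n : ℝ) : ℂ))‖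
      ≤ 4 * |θ| ^ 3 * (|(n : ℝ) - m| ^ 3 * khinchinMass f t n) := by
    intro n
    have e : (khinchinMass f t n : ℂ) * Complex.exp ((((n : ℝ) - m) * θ : ℝ) * Complex.I) -
      ((khinchinMass f t n : ℂ) + θ * Complex.I * ((((n : ℝ) - m) * khinchinMass f t n : ℝ) : ℂ)
        - (θ : ℂ) ^ 2 / 2 * ((((n : ℝ) - m) ^ 2 * khinchinMass f t n : ℝ) : ℂ))
      = (khinchinMass f t n : ℂ) * (Complex.exp ((((n : ℝ) - m) * θ : ℝ) * Complex.I) -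
        (1 + (((n : ℝ) - m) * θ : ℝ) * Complex.I - ((((n : ℝ) - m) * θ : ℝ) : ℂ) ^ 2 / 2)) := by
      push_cast
      ring
    rw [e, norm_mul, Complex.norm_real, Real.norm_of_nonneg (khinchinMass_nonneg hf ht n)]
    have := norm_exp_mul_I_sub_taylor_le (((n : ℝ) - m) * θ)
    calc _ ≤ khinchinMass f t n * (4 * |((n : ℝ) - m) * θ| ^ 3) :=
          mul_le_mul_of_nonneg_left this (khinchinMass_nonneg hf ht n)
      _ = _ := by rw [abs_mul]; ring
  have hfin := tsum_of_norm_bounded (h3.1.hasSum.mul_left (4 * |θ| ^ 3)) hterm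
  rw [hdiff.tsum_eq] at hfin
  have e : centredCharFun f t θ - (1 - khinchinVariance f t * θ ^ 2 / 2 : ℝ)
      = centredCharFun f t θ - (((1 : ℝ) : ℂ) + θ * Complex.I * ((0 : ℝ) : ℂ)
        - (θ : ℂ) ^ 2 / 2 * (khinchinVariance f t : ℂ)) := by
    push_cast
    ring
  rw [e]
  refine hfin.trans ?_
  have : 0 ≤ 4 * |θ| ^ 3 := by positivity
  nlinarith [h3.2]

/-- The atom at `0` alone contributes `m² P(X = 0)` to the variance. -/
theorem sq_mean_mul_mass_zero_le_variance (hf : f ∈ khinchinClass) {t : ℝ}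
    (ht : t ∈ khinchinDomain f)
    (hs : Summable fun n : ℕ => ((n : ℝ) - khinchinMean f t) ^ 2 * khinchinMass f t n) :
    khinchinMean f t ^ 2 * khinchinMass f t 0 ≤ khinchinVariance f t := by
  have := hs.le_tsum 0 fun n _ => mul_nonneg (sq_nonneg _) (khinchinMass_nonneg hf ht n)
  simpa [khinchinVariance] using this

/-! ### Fourier inversion for the coefficients of a power -/

theorem seriesGcd_dvd_of_coeff_pow_ne_zero (hf : f ∈ khinchinClass) (N : ℕ) :
    ∀ k : ℕ, PowerSeries.coeff k (f ^ N) ≠ 0 → seriesGcd f ∣ k := by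
  induction N with
  | zero =>
    intro k hk
    rw [pow_zero, PowerSeries.coeff_one] at hk
    have : k = 0 := by
      by_contra h
      exact hk (if_neg h)
    simp [this]
  | succ N ih =>
    intro k hk
    rw [pow_succ, PowerSeries.coeff_mul] at hk
    obtain ⟨p, hp, hne⟩ := Finset.exists_ne_zero_of_sum_ne_zero hk
    rw [← Finset.HasAntidiagonal.mem_antidiagonal.1 hp]
    exact dvd_add (ih _ (left_ne_zero_of_mul hne))
      ((seriesGcd_spec hf).2.1 _ (right_ne_zero_of_mul hne))

/-- Where a power series converges absolutely, so do its powers, with the powers of its sum. -/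
theorem summable_and_tsum_coeff_pow {z : ℂ}
    (hz : Summable fun n : ℕ => ‖((PowerSeries.coeff n f : ℝ) : ℂ) * z ^ n‖) (N : ℕ) :
    (Summable fun n : ℕ => ‖((PowerSeries.coeff n (f ^ N) : ℝ) : ℂ) * z ^ n‖) ∧
      ∑' n : ℕ, ((PowerSeries.coeff n (f ^ N) : ℝ) : ℂ) * z ^ n
        = (∑' n : ℕ, ((PowerSeries.coeff n f : ℝ) : ℂ) * z ^ n) ^ N := by
  induction N with
  | zero =>
    have h0 : ∀ n : ℕ, n ≠ 0 → ((PowerSeries.coeff n (f ^ 0) : ℝ) : ℂ) * z ^ n = 0 := by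
      intro n hn
      simp [PowerSeries.coeff_one, hn]
    refine ⟨summable_of_ne_finset_zero (s := {0}) fun n hn => ?_, ?_⟩
    · rw [h0 n (by simpa using hn), norm_zero]
    · rw [tsum_eq_single 0 h0]
      simp
  | succ N ih =>
    have hcauchy : ∀ n : ℕ, ((PowerSeries.coeff n (f ^ (N + 1)) : ℝ) : ℂ) * z ^ n
        = ∑ p ∈ Finset.HasAntidiagonal.antidiagonal n,
          (((PowerSeries.coeff p.1 (f ^ N) : ℝ) : ℂ) * z ^ p.1) *
          (((PowerSeries.coeff p.2 f : ℝ) : ℂ) * z ^ p.2) := by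
      intro n
      rw [pow_succ, PowerSeries.coeff_mul]
      push_cast
      rw [Finset.sum_mul]
      refine Finset.sum_congr rfl fun p hp => ?_
      rw [← Finset.HasAntidiagonal.mem_antidiagonal.1 hp, pow_add]
      ring
    simp only [hcauchy]
    have h1 := summable_norm_sum_mul_antidiagonal_of_summable_norm ih.1 hz
    have h2 := tsum_mul_tsum_eq_tsum_sum_antidiagonal_of_summable_norm ih.1 hz
    rw [ih.2, ← pow_succ] at h2
    exact ⟨h1, h2.symm⟩

/-- The `N`-th power of the characteristic function is that of the sum of `N` independent copies of
`X_t`, centred at its mean `N m(t)`; the masses of this sum come from the coefficients of `f ^ N`. -/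
theorem hasSum_centredCharFun_pow (hf : f ∈ khinchinClass) {t : ℝ} (ht : t ∈ khinchinDomain f)
    (N : ℕ) (θ : ℝ) :
    (Summable fun n : ℕ => ‖(PowerSeries.coeff n (f ^ N) * t ^ n / seriesValue f t ^ N : ℝ)‖) ∧
    HasSum (fun n : ℕ => ((PowerSeries.coeff n (f ^ N) * t ^ n / seriesValue f t ^ N : ℝ) : ℂ) *
      Complex.exp ((((n : ℝ) - N * khinchinMean f t) * θ : ℝ) * Complex.I))
      (centredCharFun f t θ ^ N) := by
  have hS := seriesValue_pos hf ht
  set z : ℂ := t * Complex.exp (θ * Complex.I) with hz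
  have hzn : ‖z‖ = t := by
    rw [hz, norm_mul, Complex.norm_exp_ofReal_mul_I, mul_one, Complex.norm_real,
      Real.norm_of_nonneg ht.1]
  have habs : Summable fun n : ℕ => ‖((PowerSeries.coeff n f : ℝ) : ℂ) * z ^ n‖ := by
    refine (summable_coeff_mul_pow hf ht).congr fun n => ?_
    rw [norm_mul, norm_pow, hzn, Complex.norm_real, Real.norm_of_nonneg (hf.1 n)]
  obtain ⟨h1, h2⟩ := summable_and_tsum_coeff_pow habs N
  have hexp : ∀ n : ℕ, z ^ n = (t : ℂ) ^ n * Complex.exp ((n * θ : ℝ) * Complex.I) := by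
    intro n
    rw [hz, mul_pow, ← Complex.exp_nat_mul]
    push_cast
    ring_nf
  constructor
  · refine (h1.div_const (seriesValue f t ^ N)).congr fun n => ?_
    rw [norm_mul, norm_pow, hzn, Complex.norm_real, norm_div, norm_mul, norm_pow, norm_pow,
      Real.norm_of_nonneg ht.1, Real.norm_of_nonneg hS.le]
  · have hchar : centredCharFun f t θ = (∑' n : ℕ, ((PowerSeries.coeff n f : ℝ) : ℂ) * z ^ n) *
        ((seriesValue f t : ℂ)⁻¹ * Complex.exp ((-(khinchinMean f t * θ) : ℝ) * Complex.I)) := by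
      rw [centredCharFun, ← tsum_mul_right]
      refine tsum_congr fun n => ?_
      rw [hexp, sub_mul, sub_eq_add_neg, Complex.ofReal_add, add_mul, Complex.exp_add, khinchinMass]
      push_cast
      ring
    have h3 := (Summable.of_norm h1).hasSum.mul_right
      (((seriesValue f t : ℂ)⁻¹ * Complex.exp ((-(khinchinMean f t * θ) : ℝ) * Complex.I)) ^ N)
    rw [h2, ← mul_pow, ← hchar] at h3
    refine h3.congr_fun fun n => ?_
    rw [hexp, mul_pow, ← Complex.exp_nat_mul, sub_mul, sub_eq_add_neg, Complex.ofReal_add, add_mul,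
      Complex.exp_add]
    push_cast
    ring_nf

theorem integral_exp_int_mul_period {Q : ℕ} (hQ : 0 < Q) {d : ℤ} (hd : (Q : ℤ) ∣ d) (hd0 : d ≠ 0) :
    ∫ θ in (-(Real.pi / Q))..(Real.pi / Q), Complex.exp (((d : ℝ) * θ : ℝ) * Complex.I) = 0 := by
  obtain ⟨e, rfl⟩ := hd
  have hQ' : (Q : ℂ) ≠ 0 := by exact_mod_cast hQ.ne'
  have hc : ((((Q : ℤ) * e : ℤ) : ℂ) * Complex.I) ≠ 0 :=
    mul_ne_zero (by exact_mod_cast hd0) Complex.I_ne_zero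
  have h := integral_exp_mul_complex (a := -(Real.pi / Q)) (b := Real.pi / Q) hc
  have e1 : ∀ θ : ℝ, Complex.exp (((((Q : ℤ) * e : ℤ) : ℝ) * θ : ℝ) * Complex.I)
      = Complex.exp ((((Q : ℤ) * e : ℤ) : ℂ) * Complex.I * θ) := by
    intro θ
    push_cast
    ring_nf
  simp only [e1]
  rw [h, div_eq_zero_iff]
  left
  rw [sub_eq_zero, Complex.exp_eq_exp_iff_exists_int]
  refine ⟨e, ?_⟩
  push_cast
  field_simp
  ring

/-- Fourier inversion on a single period `[-π/Q, π/Q]`. The coefficients of `f ^ N` are supported on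
the multiples of `Q`, so the characters involved are orthogonal on this shorter interval. -/
theorem integral_centredCharFun_pow (hf : f ∈ khinchinClass) {t : ℝ} (ht : t ∈ khinchinDomain f)
    {N k : ℕ} (hk : seriesGcd f ∣ k) (hmean : N * khinchinMean f t = k) :
    ∫ θ in (-(Real.pi / seriesGcd f))..(Real.pi / seriesGcd f), centredCharFun f t θ ^ N
      = ((PowerSeries.coeff k (f ^ N) * t ^ k / seriesValue f t ^ N *
          (2 * Real.pi / seriesGcd f) : ℝ) : ℂ) := by
  set Q := seriesGcd f with hQdef
  have hQ : 0 < Q := (seriesGcd_spec hf).1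
  set q : ℕ → ℝ := fun n => PowerSeries.coeff n (f ^ N) * t ^ n / seriesValue f t ^ N with hq
  have hsum := intervalIntegral.hasSum_integral_of_dominated_convergence
    (μ := MeasureTheory.volume) (a := -(Real.pi / Q)) (b := Real.pi / Q)
    (F := fun (n : ℕ) (θ : ℝ) => (q n : ℂ) *
      Complex.exp ((((n : ℝ) - N * khinchinMean f t) * θ : ℝ) * Complex.I))
    (f := fun θ => centredCharFun f t θ ^ N) (fun n _ => ‖q n‖)
    (fun n => Continuous.aestronglyMeasurable (by fun_prop))
    (fun n => Eventually.of_forall fun θ _ => by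
      rw [norm_mul, Complex.norm_exp_ofReal_mul_I, mul_one, Complex.norm_real])
    (Eventually.of_forall fun θ _ => (hasSum_centredCharFun_pow hf ht N θ).1)
    intervalIntegrable_const
    (Eventually.of_forall fun θ _ => (hasSum_centredCharFun_pow hf ht N θ).2)
  have hzero : ∀ n : ℕ, n ≠ k →
      ∫ θ in (-(Real.pi / Q))..(Real.pi / Q), (q n : ℂ) *
        Complex.exp ((((n : ℝ) - N * khinchinMean f t) * θ : ℝ) * Complex.I) = 0 := by
    intro n hn
    rw [intervalIntegral.integral_const_mul]
    by_cases h0 : PowerSeries.coeff n (f ^ N) = 0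
    · simp [hq, h0]
    · have hdvd : (Q : ℤ) ∣ (n : ℤ) - k :=
        dvd_sub (Int.natCast_dvd_natCast.2 (seriesGcd_dvd_of_coeff_pow_ne_zero hf N n h0))
          (Int.natCast_dvd_natCast.2 hk)
      have := integral_exp_int_mul_period hQ hdvd (by omega)
      push_cast at this
      rw [hmean]
      push_cast
      rw [this, mul_zero]
  rw [← hsum.tsum_eq, tsum_eq_single k hzero, hmean]
  simp only [sub_self, zero_mul, Complex.ofReal_zero, Complex.exp_zero, mul_one,
    intervalIntegral.integral_const, Complex.real_smul]
  rw [← Complex.ofReal_mul]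
  congr 1
  ring

/-! ### The local limit theorem and the asymptotics of the coefficients -/

/-- Uniformly for `t` in `[a, b]`, a compact subset of `(0, R)`, the probability that the sum of `N`
independent copies of `X_t` equals its mean is asymptotic to `Q / √(2π N σ²)`. -/
theorem tendsto_localLimit (hf : f ∈ khinchinClass) {a b : ℝ} (ha : 0 < a)
    (hb : b ∈ khinchinDomain f) {ι : Type*} {l : Filter ι} [l.IsCountablyGenerated]
    {N : ι → ℕ} (hN : Tendsto N l atTop) {k : ι → ℕ} {t : ι → ℝ}
    (ht : ∀ᶠ i in l, t i ∈ Set.Icc a b) (hk : ∀ᶠ i in l, seriesGcd f ∣ k i)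
    (hmean : ∀ᶠ i in l, N i * khinchinMean f (t i) = k i) :
    Tendsto (fun i => PowerSeries.coeff (k i) (f ^ N i) * t i ^ k i / seriesValue f (t i) ^ N i *
      (2 * Real.pi / seriesGcd f) * (√(N i : ℝ) * khinchinSigma f (t i))) l
      (𝓝 √(2 * Real.pi)) := by
  have hQ : (0 : ℝ) < seriesGcd f := by exact_mod_cast (seriesGcd_spec hf).1
  by_cases hab : a ≤ b
  swap
  · have : l = ⊥ := by
      rw [← eventually_false_iff_eq_bot]
      filter_upwards [ht] with i hi
      exact hab (hi.1.trans hi.2)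
    rw [this]
    exact tendsto_bot
  have had := mem_khinchinDomain_of_le ha.le hab hb
  have hS := seriesValue_pos hf hb
  have h0 : 0 < PowerSeries.coeff 0 f := hf.2.1
  have hma := khinchinMean_pos hf had ha
  obtain ⟨c, hc, hdecay⟩ := exists_norm_centredCharFun_le hf ha hb
  obtain ⟨K, hK⟩ := exists_centred_moment_bound hf hb
  have hdom : ∀ x ∈ Set.Icc a b, x ∈ khinchinDomain f := fun x hx =>
    mem_khinchinDomain_of_le (ha.le.trans hx.1) hx.2 hb
  have hK' : ∀ x ∈ Set.Icc a b, ∀ j ≤ 3,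
      (Summable fun n : ℕ => |(n : ℝ) - khinchinMean f x| ^ j * khinchinMass f x n) ∧
      ∑' n : ℕ, |(n : ℝ) - khinchinMean f x| ^ j * khinchinMass f x n ≤ K := fun x hx =>
    hK x ⟨ha.le.trans hx.1, hx.2⟩
  have hvar : ∀ x ∈ Set.Icc a b, khinchinVariance f x ≤ K := by
    intro x hx
    have := (hK' x hx 2 (by norm_num)).2
    simp only [sq_abs] at this
    exact this
  have hlow : ∀ x ∈ Set.Icc a b,
      khinchinMean f a ^ 2 * (PowerSeries.coeff 0 f * a ^ 0 / seriesValue f b)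
        ≤ khinchinVariance f x := by
    intro x hx
    have hs := (hK' x hx 2 (by norm_num)).1
    simp only [sq_abs] at hs
    refine le_trans ?_ (sq_mean_mul_mass_zero_le_variance hf (hdom x hx) hs)
    have h1 := coeff_mul_pow_div_le_khinchinMass hf ha.le hb hx 0
    have h2 := (khinchinMean_strictMonoOn hf).monotoneOn had (hdom x hx) hx.1
    gcongr
  have hK0 : 0 ≤ K := by
    refine le_trans ?_ ((hlow a ⟨le_rfl, hab⟩).trans (hvar a ⟨le_rfl, hab⟩))
    positivity
  have key := tendsto_sqrt_mul_integral_pow (l := l) hN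
    (g := fun i => centredCharFun f (t i)) (v := fun i => khinchinVariance f (t i)) (C := 4 * K)
    (L := Real.pi / seriesGcd f)
    (s := khinchinMean f a ^ 2 * (PowerSeries.coeff 0 f * a ^ 0 / seriesValue f b))
    hc (by positivity) (by positivity)
    (ht.mono fun i hi => continuous_centredCharFun hf (hdom _ hi))
    (ht.mono fun i hi => hlow _ hi)
    (ht.mono fun i hi => (hvar _ hi).trans (by linarith))
    (ht.mono fun i hi => hdecay _ hi)
    (ht.mono fun i hi => norm_centredCharFun_sub_le hf (hdom _ hi) (hK' _ hi))
  have hre := (Complex.continuous_re.tendsto _).comp key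
  rw [Complex.ofReal_re] at hre
  refine hre.congr' ?_
  filter_upwards [ht, hk, hmean] with i h1 h2 h3
  simp only [Function.comp_apply]
  rw [integral_centredCharFun_pow hf (hdom _ h1) h2 h3, ← Complex.ofReal_mul, Complex.ofReal_re,
    khinchinSigma]
  ring

end

theorem mainTheorem2 (ψ : PowerSeries ℝ) (hψ : ψ ∈ khinchinClass) (A B : ℝ)
    (hA : 0 < A) (hAB : A < B) (hB : (B : EReal) < khinchinMeanLimit ψ) :
    (∀ n k : ℕ, (n, k) ∈ comparablePairs ψ A B →
      ∃! t : ℝ, t ∈ khinchinDomain ψ ∧ khinchinMean ψ t = (k : ℝ) / (n : ℝ)) ∧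
    ∀ τ : ℕ → ℕ → ℝ,
      (∀ n k : ℕ, (n, k) ∈ comparablePairs ψ A B →
        τ n k ∈ khinchinDomain ψ ∧ khinchinMean ψ (τ n k) = (k : ℝ) / (n : ℝ)) →
      (fun p : ℕ × ℕ => PowerSeries.coeff p.2 (ψ ^ p.1))
        ~[powerTendsTo (comparablePairs ψ A B)]
      (fun p : ℕ × ℕ =>
        (seriesGcd ψ : ℝ) / √(2 * Real.pi) *
          (seriesValue ψ (τ p.1 p.2) ^ p.1 / τ p.1 p.2 ^ p.2) *
          (1 / (√(p.1 : ℝ) * khinchinSigma ψ (τ p.1 p.2)))) := by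
  obtain ⟨b, hb, hBb⟩ := exists_lt_khinchinMean hψ hB
  have hmono := khinchinMean_strictMonoOn hψ
  refine ⟨fun n k hnk => ?_, fun τ hτ => ?_⟩
  · obtain ⟨t, ht, htm⟩ := exists_khinchinMean_eq hψ hb (x := (k : ℝ) / n) (by positivity)
      (hnk.2.2.1.trans hBb.le)
    exact ⟨t, ⟨ht, htm⟩, fun s hs => hmono.injOn hs.1 ht (hs.2.trans htm.symm)⟩
  · obtain ⟨a, had, ham⟩ := exists_khinchinMean_eq hψ hb hA.le (hAB.le.trans hBb.le)
    have ha : 0 < a := by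
      refine had.1.lt_of_ne fun h => ?_
      rw [← h, khinchinMean_zero] at ham
      exact hA.ne ham
    have hQ : (0 : ℝ) < seriesGcd ψ := by exact_mod_cast (seriesGcd_spec hψ).1
    have : (powerTendsTo (comparablePairs ψ A B)).IsCountablyGenerated := by
      unfold powerTendsTo
      infer_instance
    have hmem : ∀ᶠ p in powerTendsTo (comparablePairs ψ A B), p ∈ comparablePairs ψ A B :=
      mem_inf_of_right (mem_principal_self _)
    have hN : Tendsto Prod.fst (powerTendsTo (comparablePairs ψ A B)) atTop :=
      tendsto_comap.mono_left inf_le_left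
    have hIcc : ∀ p ∈ comparablePairs ψ A B, τ p.1 p.2 ∈ Set.Icc a b := by
      intro p hp
      obtain ⟨h1, h2⟩ := hτ p.1 p.2 hp
      constructor
      · rw [← hmono.le_iff_le had h1, ham, h2]
        exact hp.2.1
      · rw [← hmono.le_iff_le h1 hb, h2]
        exact hp.2.2.1.trans hBb.le
    have hlim := tendsto_localLimit hψ ha hb hN (k := Prod.snd) (t := fun p => τ p.1 p.2)
      (hmem.mono hIcc) (hmem.mono fun p hp => hp.2.2.2)
      (hmem.mono fun p hp => by
        have h1 : (0 : ℝ) < p.1 := by exact_mod_cast hp.1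
        rw [(hτ p.1 p.2 hp).2]
        field_simp)
    have hpi : 0 < √(2 * Real.pi) := by positivity
    -- The normalisation excludes a vanishing `σ`, as the limit is not zero.
    have hσ : ∀ᶠ p in powerTendsTo (comparablePairs ψ A B),
        √(p.1 : ℝ) * khinchinSigma ψ (τ p.1 p.2) ≠ 0 := by
      filter_upwards [hlim.eventually_ne hpi.ne'] with p hp
      exact right_ne_zero_of_mul hp
    refine (isEquivalent_iff_tendsto_one ?_).2 ?_
    · filter_upwards [hmem, hσ] with p hp hs
      have h1 : 0 < τ p.1 p.2 := ha.trans_le (hIcc p hp).1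
      have h2 := seriesValue_pos hψ (hτ p.1 p.2 hp).1
      have h3 := h1.ne'
      positivity
    · have h := hlim.div_const √(2 * Real.pi)
      rw [div_self hpi.ne'] at h
      refine h.congr' ?_
      filter_upwards [hmem, hσ] with p hp hs
      have h1 : 0 < τ p.1 p.2 := ha.trans_le (hIcc p hp).1
      have h2 := seriesValue_pos hψ (hτ p.1 p.2 hp).1
      have h3 : √(2 * Real.pi) ^ 2 = 2 * Real.pi := Real.sq_sqrt (by positivity)
      have h4 := left_ne_zero_of_mul hs
      have h5 := right_ne_zero_of_mul hs
      rw [Pi.div_apply]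
      generalize √(2 * Real.pi) = c at h3 hpi ⊢
      rw [← h3]
      field_simp
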